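/- Let $\mathbb{F}=\mathbb{F}_2$, let $\mathscr{V}^f$ be the category of finite-dimensional $\mathbb{F}$-vector spaces, and let $\mathscr{FA}$ be the abelian category of functors from $\mathscr{V}^f$ to abelian groups. For $R=\mathbb{Z}$ or $R=\mathbb{F}$ and $n\geq 1$, let $\overline{P}_R^n\in\mathscr{FA}$ be the functor $V\mapsto I_R(V)^n$, where $I_R(V)\subset R[V]$ is the augmentation ideal of the group ring; let $2\overline{P}_{\mathbb{Z}}^n$ be the subfunctor $V\mapsto 2\cdot I_{\mathbb{Z}}(V)^n$ of $V \mapsto \mathbb{Z}[V]$. Let $\overline{I}_{\mathbb{F}}\in\mathscr{FA}$ be the functor that sends $V$ to the space of set maps $f:V^\sharp\to\mathbb{F}$ with $f(0)=0$, where $V^\sharp$ is the dual of $V$. Its reduced diagonal $\Delta:\overline{I}_{\mathbb{F}}\to\overline{I}_{\mathbb{F}}\otimes\overline{I}_{\mathbb{F}}$ is induced by $f\mapsto\big((x,y)\mapsto f(x+y)\big)$, under the isomorphism $\mathbb{F}^{V^\sharp}\otimes\mathbb{F}^{V^\sharp}\cong\mathbb{F}^{V^\sharp\times V^\sharp}$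 and the projection $\mathbb{F}^{V^\sharp}\to\overline{I}_{\mathbb{F}}(V)$, $f\mapsto f-f(0)$. Let $p_n\overline{I}_{\mathbb{F}}\subset\overline{I}_{\mathbb{F}}$ be the kernel of the iterated diagonal $\Delta^{(n+1)}:\overline{I}_{\mathbb{F}}\to\overline{I}_{\mathbb{F}}^{\otimes (n+1)}$. Then, for every integer $n>0$: 1. $2\overline{P}_{\mathbb{Z}}^n$ is contained in $\overline{P}_{\mathbb{Z}}^{n+1}$, and there is a short exact sequence in $\mathscr{FA}$ $$0\to 2\overline{P}_{\mathbb{Z}}^n\to\overline{P}_{\mathbb{Z}}^{n+1}\to\overline{P}_{\mathbb{F}}^{n+1}\to 0,$$ in which the first morphism is the inclusion and the second one is reduction of coefficients modulo $2$. 2. There is a unique non-zero morphism $\varphi:\overline{P}_{\mathbb{Z}}^n\to\overline{I}_{\mathbb{F}}$ in $\mathscr{FA}$, and it induces an isomorphism in $\mathscr{FA}$ $$\overline{P}_{\mathbb{Z}}^n/\overline{P}_{\mathbb{Z}}^{n+1}\;\xrightarrow{\ \cong\ }\;p_n\overline{I}_{\mathbb{F}};$$ that is, $\varphi$ is the composite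 of the projection $\overline{P}_{\mathbb{Z}}^n\to\overline{P}_{\mathbb{Z}}^n/\overline{P}_{\mathbb{Z}}^{n+1}$, this isomorphism, and the inclusion $p_n\overline{I}_{\mathbb{F}}\subset\overline{I}_{\mathbb{F}}$. -/

import Mathlib

open CategoryTheory CategoryTheory.Limits
open scoped TensorProduct

universe u

noncomputable section

namespace IntegralGroupRing

/-- The category of finite-dimensional vector spaces over the field with two elements. -/
abbrev Vf := FGModuleCat.{u} (ZMod 2)

/-- The category of functors from finite-dimensional `𝔽₂`-vector spaces to abelian groups. -/
abbrev FA := Vf.{u} ⥤ AddCommGrpCat.{u}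

/-! ### Subfunctors of functors to abelian groups -/

/-- A subfunctor of `F`: a family of subgroups of the values of `F`, stable under all maps. -/
@[ext]
structure SubFA (F : FA.{u}) where
  obj : ∀ V : Vf.{u}, AddSubgroup (F.obj V)
  map_mem : ∀ {V W : Vf.{u}} (f : V ⟶ W) (x : F.obj V), x ∈ obj V → (F.map f).hom x ∈ obj W

namespace SubFA

variable {F : FA.{u}}

instance : LE (SubFA F) := ⟨fun G H => ∀ V, G.obj V ≤ H.obj V⟩

/-- A subfunctor, regarded as a functor. -/
def toFunctor (G : SubFA F) : FA.{u} where
  obj V := AddCommGrpCat.of (G.obj V)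
  map {V W} f := AddCommGrpCat.ofHom
    (((F.map f).hom.comp (G.obj V).subtype).codRestrict (G.obj W)
      (fun x => G.map_mem f x.1 x.2))
  map_id V := by
    ext x
    simp
  map_comp f g := by
    refine AddCommGrpCat.hom_ext (AddMonoidHom.ext fun x => Subtype.ext ?_)
    exact congrArg (fun h => h.hom x.1) (F.map_comp f g)

/-- The inclusion of a subfunctor in the ambient functor. -/
def ι (G : SubFA F) : G.toFunctor ⟶ F where
  app V := AddCommGrpCat.ofHom (G.obj V).subtype
  naturality _ _ _ := rfl

/-- The inclusion of a subfunctor in a larger subfunctor. -/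
def incl {G H : SubFA F} (h : G ≤ H) : G.toFunctor ⟶ H.toFunctor where
  app V := AddCommGrpCat.ofHom (AddSubgroup.inclusion (h V))
  naturality _ _ _ := rfl

/-- The subfunctor `m • G`, whose values are the subgroups `{m • x | x ∈ G V}`. -/
def mul (m : ℤ) (G : SubFA F) : SubFA F where
  obj V := (G.obj V).map (zsmulAddGroupHom m)
  map_mem {V W} f x hx := by
    obtain ⟨y, hy, rfl⟩ := hx
    exact ⟨(F.map f).hom y, G.map_mem f y hy, by simp⟩

/-- The morphism between subfunctors that is induced by a morphism `α` of the ambient functors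
which sends the first subfunctor to the second one. -/
def restrict {F' : FA.{u}} (α : F ⟶ F') (G : SubFA F) (G' : SubFA F')
    (h : ∀ V (x : F.obj V), x ∈ G.obj V → (α.app V).hom x ∈ G'.obj V) :
    G.toFunctor ⟶ G'.toFunctor where
  app V := AddCommGrpCat.ofHom
    (((α.app V).hom.comp (G.obj V).subtype).codRestrict (G'.obj V) (fun x => h V x.1 x.2))
  naturality V W f := by
    ext x
    exact Subtype.ext (ConcreteCategory.congr_hom (α.naturality f) x.1)

end SubFA

/-! ### Group rings and the powers of the augmentation ideal -/

section GroupRing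

variable (R : Type) [CommRing R]

/-- The group ring functor `P_R : V ↦ R[V]`. -/
def groupRing : FA.{u} where
  obj V := AddCommGrpCat.of (AddMonoidAlgebra R V)
  map f := AddCommGrpCat.ofHom
    (AddMonoidAlgebra.mapDomainRingHom R f.hom.hom.toAddMonoidHom).toAddMonoidHom
  map_id V := by
    refine AddCommGrpCat.hom_ext (AddMonoidHom.ext fun x => ?_)
    exact congrArg (fun g => g x) (AddMonoidAlgebra.mapDomainRingHom_id (R := R) (M := V))
  map_comp f g := by
    refine AddCommGrpCat.hom_ext (AddMonoidHom.ext fun x => ?_)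
    exact (congrArg (fun h => h x) (AddMonoidAlgebra.mapDomainRingHom_comp (R := R)
      g.hom.hom.toAddMonoidHom f.hom.hom.toAddMonoidHom))

/-- The augmentation `R[V] → R`, `∑ r_v [v] ↦ ∑ r_v`. -/
def aug (V : Type u) [AddCommGroup V] : AddMonoidAlgebra R V →ₐ[R] R :=
  AddMonoidAlgebra.lift R R V 1

/-- The augmentation ideal of `R[V]`. -/
def augIdeal (V : Type u) [AddCommGroup V] : Ideal (AddMonoidAlgebra R V) :=
  RingHom.ker (aug R V)

variable {R} in
theorem map_mem_augIdeal_pow {V W : Type u} [AddCommGroup V] [AddCommGroup W] (f : V →+ W) (n : ℕ)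
    (x : AddMonoidAlgebra R V) (hx : x ∈ augIdeal R V ^ n) :
    AddMonoidAlgebra.mapDomainRingHom R f x ∈ augIdeal R W ^ n := by
  have h1 : augIdeal R V ≤ (augIdeal R W).comap (AddMonoidAlgebra.mapDomainRingHom R f) := by
    intro y hy
    have key : (aug R W : AddMonoidAlgebra R W →+* R).comp (AddMonoidAlgebra.mapDomainRingHom R f) =
        (aug R V : AddMonoidAlgebra R V →+* R) := by
      ext <;> simp [aug]
    have := congrArg (fun g => g y) key
    exact this.trans hy
  exact Ideal.mem_comap.1 (Ideal.le_comap_pow _ n (Ideal.pow_right_mono h1 n hx))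

/-- The functor `V ↦ I(V)ⁿ`, where `I(V)` is the augmentation ideal of `R[V]`. -/
def Pbar (n : ℕ) : SubFA (groupRing.{u} R) where
  obj V := Submodule.toAddSubgroup (augIdeal R V ^ n)
  map_mem f x hx := map_mem_augIdeal_pow f.hom.hom.toAddMonoidHom n x hx

theorem Pbar_succ_le (n : ℕ) : Pbar.{u} R (n + 1) ≤ Pbar R n :=
  fun V => show augIdeal R V ^ (n + 1) ≤ augIdeal R V ^ n from
    Ideal.pow_le_pow_right (Nat.le_succ n)

end GroupRing

/-- Reduction of coefficients modulo two, `ℤ[V] → 𝔽[V]`. -/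
def redHom (V : Type u) [AddCommGroup V] : AddMonoidAlgebra ℤ V →+* AddMonoidAlgebra (ZMod 2) V :=
  AddMonoidAlgebra.mapRingHom V (Int.castRingHom (ZMod 2))

theorem redHom_comp {V W : Type u} [AddCommGroup V] [AddCommGroup W] (f : V →+ W) :
    (redHom W).comp (AddMonoidAlgebra.mapDomainRingHom ℤ f) =
      (AddMonoidAlgebra.mapDomainRingHom (ZMod 2) f).comp (redHom V) := by
  ext <;> simp [redHom]

theorem redHom_mem {V : Type u} [AddCommGroup V] (n : ℕ) (x : AddMonoidAlgebra ℤ V)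
    (hx : x ∈ augIdeal ℤ V ^ n) : redHom V x ∈ augIdeal (ZMod 2) V ^ n := by
  have key : (aug (ZMod 2) V : AddMonoidAlgebra (ZMod 2) V →+* ZMod 2).comp (redHom V) =
      (Int.castRingHom (ZMod 2)).comp (aug ℤ V : AddMonoidAlgebra ℤ V →+* ℤ) := by
    ext <;> simp [aug, redHom]
  have h1 : augIdeal ℤ V ≤ (augIdeal (ZMod 2) V).comap (redHom V) := by
    intro y hy
    have hy' : (aug ℤ V) y = 0 := hy
    have h2 : aug (ZMod 2) V (redHom V y) = ((aug ℤ V y : ℤ) : ZMod 2) :=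
      congrArg (fun g => g y) key
    rw [hy', Int.cast_zero] at h2
    exact h2
  exact Ideal.mem_comap.1 (Ideal.le_comap_pow _ n (Ideal.pow_right_mono h1 n hx))

/-- Reduction of coefficients modulo two, as a morphism `P_ℤ → P_𝔽`. -/
def reduction : groupRing.{u} ℤ ⟶ groupRing.{u} (ZMod 2) where
  app V := AddCommGrpCat.ofHom (redHom V).toAddMonoidHom
  naturality V W f := by
    refine AddCommGrpCat.hom_ext (AddMonoidHom.ext fun x => ?_)
    exact congrArg (fun g => g x) (redHom_comp f.hom.hom.toAddMonoidHom)

/-- The morphism `P̄_ℤⁿ → P̄_𝔽ⁿ` that is induced by reduction modulo two. -/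
def reductionPow (n : ℕ) : (Pbar.{u} ℤ n).toFunctor ⟶ (Pbar.{u} (ZMod 2) n).toFunctor :=
  SubFA.restrict reduction _ _ (fun _ x hx => redHom_mem n x hx)

/-! ### The functor `Ī_𝔽` and the kernels of its iterated diagonals -/

section Functions

variable (A B : Type u) [AddCommGroup A] [AddCommGroup B]

/-- The functions `A → 𝔽` that vanish at `0`. With `A` the dual of `V`, this is `Ī_𝔽(V)`. -/
def redFun : Submodule (ZMod 2) (A → ZMod 2) where
  carrier := {f | f 0 = 0}
  zero_mem' := rfl
  add_mem' {f g} hf hg := by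
    rw [Set.mem_ofPred_eq] at *
    rw [Pi.add_apply, hf, hg, add_zero]
  smul_mem' c f hf := by
    rw [Set.mem_ofPred_eq] at *
    rw [Pi.smul_apply, hf, smul_zero]

/-- The projection of the space of all functions to the functions that vanish at `0`, along the
constant functions. -/
def toRedFun : (A → ZMod 2) →ₗ[ZMod 2] redFun A where
  toFun f := ⟨fun x => f x - f 0, sub_self (f 0)⟩
  map_add' f g := Subtype.ext (funext fun x => add_sub_add_comm (f x) (g x) (f 0) (g 0))
  map_smul' c f := Subtype.ext (funext fun x => (mul_sub c (f x) (f 0)).symm)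

/-- The diagonal `𝔽^A → 𝔽^A ⊗ 𝔽^A`: a function `f` is sent to the function
`(x, y) ↦ f (x + y)` on `A × A`, under the isomorphism `𝔽^A ⊗ 𝔽^A ≅ 𝔽^(A × A)`. -/
def funDiag [Finite A] : (A → ZMod 2) →ₗ[ZMod 2] (A → ZMod 2) ⊗[ZMod 2] (A → ZMod 2) :=
  letI := Fintype.ofFinite A
  letI := Classical.decEq A
  (TensorProduct.piScalarRight (ZMod 2) (ZMod 2) (A → ZMod 2) A).symm.toLinearMap ∘ₗ
    (LinearMap.pi fun y => LinearMap.pi fun x => LinearMap.proj (x + y))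

/-- The reduced diagonal `Ī → Ī ⊗ Ī`. -/
def redDiag [Finite A] : redFun A →ₗ[ZMod 2] redFun A ⊗[ZMod 2] redFun A :=
  TensorProduct.map (toRedFun A) (toRedFun A) ∘ₗ funDiag A ∘ₗ (redFun A).subtype

/-- `tensorPower M k` is the tensor power `M ⊗ ⋯ ⊗ M` with `k + 1` factors. -/
def tensorPower (M : ModuleCat.{u} (ZMod 2)) : ℕ → ModuleCat.{u} (ZMod 2)
  | 0 => M
  | k + 1 => ModuleCat.of (ZMod 2) (tensorPower M k ⊗[ZMod 2] M)

/-- The iterated reduced diagonal `Δ^{(k+1)} : Ī → Ī ⊗ ⋯ ⊗ Ī`, with `k + 1` factors `Ī` in the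
target; for `k = 0` it is the identity. -/
def iterDiag [Finite A] : (k : ℕ) →
    (redFun A →ₗ[ZMod 2] tensorPower (ModuleCat.of (ZMod 2) (redFun A)) k)
  | 0 => LinearMap.id
  | k + 1 => (TensorProduct.map (iterDiag k) LinearMap.id) ∘ₗ redDiag A

variable {A B}

/-- Precomposition with an additive map, on functions that vanish at `0`. -/
def redFunMap (g : B →+ A) : redFun A →ₗ[ZMod 2] redFun B :=
  ((LinearMap.funLeft (ZMod 2) (ZMod 2) g).comp (redFun A).subtype).codRestrict _ (fun f => by
    have h : (f : A → ZMod 2) 0 = 0 := f.2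
    change (f : A → ZMod 2) (g 0) = 0
    rw [map_zero, h])

theorem toRedFun_comp (g : B →+ A) :
    toRedFun B ∘ₗ LinearMap.funLeft (ZMod 2) (ZMod 2) g = redFunMap g ∘ₗ toRedFun A := by
  refine LinearMap.ext fun f => Subtype.ext (funext fun x => ?_)
  change f (g x) - f (g 0) = f (g x) - f 0
  rw [map_zero]

theorem funDiag_comp [Finite A] [Finite B] (g : B →+ A) (f : A → ZMod 2) :
    funDiag B (LinearMap.funLeft (ZMod 2) (ZMod 2) g f) =
      TensorProduct.map (LinearMap.funLeft (ZMod 2) (ZMod 2) g)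
        (LinearMap.funLeft (ZMod 2) (ZMod 2) g) (funDiag A f) := by
  let _ := Fintype.ofFinite A
  let _ := Fintype.ofFinite B
  let _ := Classical.decEq A
  let _ := Classical.decEq B
  have key : ∀ t : (A → ZMod 2) ⊗[ZMod 2] (A → ZMod 2), ∀ x y : B,
      TensorProduct.piScalarRight (ZMod 2) (ZMod 2) (B → ZMod 2) B
        (TensorProduct.map (LinearMap.funLeft (ZMod 2) (ZMod 2) g)
          (LinearMap.funLeft (ZMod 2) (ZMod 2) g) t) y x =
      TensorProduct.piScalarRight (ZMod 2) (ZMod 2) (A → ZMod 2) A t (g y) (g x) := by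
    intro t x y
    induction t with
    | zero => simp
    | tmul a b => simp [LinearMap.funLeft_apply]
    | add a b ha hb => simp only [map_add, Pi.add_apply, ha, hb]
  apply (TensorProduct.piScalarRight (ZMod 2) (ZMod 2) (B → ZMod 2) B).injective
  ext y x
  rw [key]
  simp [funDiag, LinearMap.funLeft_apply]

theorem redDiag_comp [Finite A] [Finite B] (g : B →+ A) (f : redFun A) :
    redDiag B (redFunMap g f) =
      TensorProduct.map (redFunMap g) (redFunMap g) (redDiag A f) := by
  have h : (redFunMap g f : B → ZMod 2) = LinearMap.funLeft (ZMod 2) (ZMod 2) g f := rfl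
  simp only [redDiag, LinearMap.comp_apply, Submodule.subtype_apply, h, funDiag_comp]
  have h1 := TensorProduct.map_comp (toRedFun B) (toRedFun B) (LinearMap.funLeft (ZMod 2) (ZMod 2) g)
    (LinearMap.funLeft (ZMod 2) (ZMod 2) g)
  rw [toRedFun_comp, TensorProduct.map_comp] at h1
  exact (congrArg (fun L => L (funDiag A f)) h1).symm

theorem iterDiag_comp [Finite A] [Finite B] (g : B →+ A) (k : ℕ) :
    ∃ T : tensorPower (ModuleCat.of (ZMod 2) (redFun A)) k →ₗ[ZMod 2]
        tensorPower (ModuleCat.of (ZMod 2) (redFun B)) k,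
      iterDiag B k ∘ₗ redFunMap g = T ∘ₗ iterDiag A k := by
  induction k with
  | zero => exact ⟨redFunMap g, rfl⟩
  | succ k ih =>
    obtain ⟨T, hT⟩ := ih
    refine ⟨TensorProduct.map T (redFunMap g), ?_⟩
    apply LinearMap.ext
    intro f
    change TensorProduct.map (iterDiag B k) LinearMap.id (redDiag B (redFunMap g f)) =
      TensorProduct.map T (redFunMap g)
        (TensorProduct.map (iterDiag A k) LinearMap.id (redDiag A f))
    have h1 := TensorProduct.map_comp (iterDiag B k) LinearMap.id (redFunMap g) (redFunMap g)
    have h2 := TensorProduct.map_comp T (redFunMap g) (iterDiag A k) LinearMap.id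
    rw [hT, LinearMap.id_comp] at h1
    rw [LinearMap.comp_id] at h2
    rw [redDiag_comp]
    exact congrArg (fun L => L (redDiag A f)) (h1.symm.trans h2)

end Functions

instance finite_dual (V : Vf.{u}) : Finite (Module.Dual (ZMod 2) V) :=
  Module.finite_of_finite (ZMod 2)

/-- The functor `Ī_𝔽`, which sends `V` to the space of set maps `V^♯ → 𝔽` that vanish at `0`. -/
def Ibar : FA.{u} where
  obj V := AddCommGrpCat.of (redFun (Module.Dual (ZMod 2) V))
  map f := AddCommGrpCat.ofHom (redFunMap f.hom.hom.dualMap.toAddMonoidHom).toAddMonoidHom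
  map_id _ := rfl
  map_comp _ _ := rfl

/-- `p_n Ī_𝔽`, the kernel of the iterated diagonal `Δ^{(n+1)} : Ī_𝔽 → Ī_𝔽^{⊗ (n+1)}`. -/
def pI (n : ℕ) : SubFA Ibar.{u} where
  obj V := (LinearMap.ker (iterDiag (Module.Dual (ZMod 2) V) n)).toAddSubgroup
  map_mem {V W} f x hx := by
    obtain ⟨T, hT⟩ := iterDiag_comp f.hom.hom.dualMap.toAddMonoidHom n
    have h1 : iterDiag (Module.Dual (ZMod 2) V) n x = 0 := hx
    have h2 := congrArg (fun L => L x) hT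
    exact h2.trans ((congrArg T h1).trans (map_zero T))

end IntegralGroupRing

end

open IntegralGroupRing

/-!
The argument rests on the ring homomorphisms `ch χ : ℤ[V] → ℤ`, `[v] ↦ (-1)^χ(v)`, indexed by the
linear forms `χ` on `V`. Each of them sends `[v] - 1` to `-2 χ(v)`, hence `I(V)ⁿ` to `2ⁿ ℤ`. For
`n > 0` there is a converse, `mem_augIdeal_pow_iff`: an element of `I(V)` lies in `I(V)ⁿ` as soon as
all its images under the characters are divisible by `2ⁿ`. Indeed, with a basis `b` of `V`, write
the element as `∑ a_S ∏_{i ∈ S} ([b i] - 1)`; Möbius inversion over the subsets of the basis shows that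
`2ⁿ` divides `a_S 2^|S|`, and `2^(n - |S|) ∏_{i ∈ S} ([b i] - 1)` lies in `I(V)ⁿ` because
`([v] - 1)² = -2 ([v] - 1)`. This criterion gives at once that `2 x ∈ I(V)ⁿ⁺¹` if and only if
`x ∈ I(V)ⁿ`, which is the exactness of the sequence of reduction modulo two.

The non-zero morphism is `leading`, `x ↦ (χ ↦ ch χ x / 2ⁿ mod 2)`; by the criterion, its kernel is
`I(V)ⁿ⁺¹`. It sends `∏ ([v i] - 1)` to the function `χ ↦ ∏ χ (v i)`. By evaluating the last tensor
factor, the kernel of the iterated diagonal is described recursively through the operators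
`f ↦ f (x + y) - f x - f y` (`mem_polyFun_succ`), so that it consists of the polynomial functions of
degree at most `n`. It contains the products of `n` linear forms (`mulLin_mem`), and conversely the
coefficients of its elements in the square-free monomials of degree more than `n` vanish, since they
are cross effects (`sum_powerset_eq_zero`). Hence the image of `leading` is `p_n Ī`
(`leading_mem`, `exists_leading_eq`).

For uniqueness (`hom_unique`), a morphism `ψ` on `I(V)ⁿ` is determined by its value at the
element `∏ ([e_i] - 1)` of `ℤ[𝔽₂ⁿ]`, as these products generate `I(V)ⁿ` additively. That value is a
function of `χ` which vanishes unless `χ(e_i) = 1` for all `i`, by naturality with respect to the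
maps that kill one basis vector. So there is at most one non-zero value.
-/

noncomputable section

namespace IntegralGroupRing

/-! ### The group ring of an elementary abelian group and its sign characters -/

section Algebra

variable {V : Type u} [AddCommGroup V]

/-- The element `[v] - 1` of the augmentation ideal. -/
def gen (v : V) : AddMonoidAlgebra ℤ V := AddMonoidAlgebra.single v 1 - 1

theorem gen_mem (v : V) : gen v ∈ augIdeal ℤ V := by
  change aug ℤ V (gen v) = 0
  simp [gen, aug]

@[simp] theorem gen_zero : gen (0 : V) = 0 := by
  simp [gen, AddMonoidAlgebra.one_def]

theorem mapDomain_gen {W : Type u} [AddCommGroup W] (g : V →+ W) (v : V) :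
    AddMonoidAlgebra.mapDomainRingHom ℤ g (gen v) = gen (g v) := by
  rw [gen, map_sub, map_one]
  simp [gen]

/-- Additively, the augmentation ideal is generated by the elements `[v] - 1`. -/
theorem augIdeal_le_span :
    (augIdeal ℤ V).restrictScalars ℤ ≤ Submodule.span ℤ (Set.range (gen (V := V))) := by
  have key : ∀ x : AddMonoidAlgebra ℤ V,
      x - algebraMap ℤ _ (aug ℤ V x) ∈ Submodule.span ℤ (Set.range (gen (V := V))) := by
    intro x
    induction x using AddMonoidAlgebra.induction_linear with
    | zero => simp
    | add x y hx hy =>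
      rw [map_add, map_add, add_sub_add_comm]
      exact add_mem hx hy
    | single v r =>
      have h : AddMonoidAlgebra.single v r - algebraMap ℤ _ (aug ℤ V (.single v r)) =
          r • gen v := by
        simp [gen, aug, smul_sub, AddMonoidAlgebra.one_def, AddMonoidAlgebra.intCast_def]
      rw [h]
      exact Submodule.smul_mem _ _ (Submodule.subset_span ⟨v, rfl⟩)
  intro x hx
  have hx : aug ℤ V x = 0 := hx
  simpa [hx] using key x

/-- Additively, a positive power of the augmentation ideal is generated by the products of elements
`[v] - 1`. -/
theorem augIdeal_pow_le_span {n : ℕ} (hn : 0 < n) :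
    (augIdeal ℤ V ^ n).restrictScalars ℤ ≤
      Submodule.span ℤ (Set.range fun v : Fin n → V => ∏ i, gen (v i)) := by
  induction n, hn using Nat.le_induction with
  | base =>
    rw [pow_one]
    refine augIdeal_le_span.trans (Submodule.span_mono ?_)
    rintro _ ⟨v, rfl⟩
    exact ⟨fun _ => v, by simp⟩
  | succ n hn ih =>
    intro x hx
    have hx : x ∈ augIdeal ℤ V ^ n * augIdeal ℤ V := by rw [← pow_succ]; exact hx
    refine Submodule.mul_induction_on hx (fun y hy z hz => ?_) (fun _ _ => add_mem)
    have h := Submodule.mul_mem_mul (ih hy) (augIdeal_le_span hz)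
    rw [Submodule.span_mul_span] at h
    refine Submodule.span_mono ?_ h
    rintro _ ⟨_, ⟨v, rfl⟩, _, ⟨w, rfl⟩, rfl⟩
    exact ⟨Fin.snoc v w, by simp [Fin.prod_univ_castSucc]⟩

/-- The ring homomorphism `ℤ[V] → ℤ`, `[v] ↦ (-1)^χ(v)`, of an additive map `χ : V → 𝔽₂`. -/
def ch (χ : V →+ ZMod 2) : AddMonoidAlgebra ℤ V →ₐ[ℤ] ℤ :=
  AddMonoidAlgebra.lift ℤ ℤ V
    { toFun := fun v => if χ v.toAdd = 0 then 1 else -1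
      map_one' := by simp
      map_mul' := fun v w => by
        rw [toAdd_mul, map_add]
        generalize χ v.toAdd = a
        generalize χ w.toAdd = b
        revert a b
        decide }

theorem ch_single (χ : V →+ ZMod 2) (v : V) :
    ch χ (.single v 1) = if χ v = 0 then 1 else -1 := by
  simp [ch]

theorem ch_gen (χ : V →+ ZMod 2) (v : V) : ch χ (gen v) = -2 * ((χ v).val : ℤ) := by
  rw [gen, map_sub, ch_single, map_one]
  generalize χ v = a
  revert a
  decide

theorem ch_zero (x : AddMonoidAlgebra ℤ V) : ch 0 x = aug ℤ V x := by
  have h : ch (0 : V →+ ZMod 2) = aug ℤ V := by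
    ext v
    simp [ch, aug]
  rw [h]

theorem ch_mapDomain {W : Type u} [AddCommGroup W] (g : V →+ W) (χ : W →+ ZMod 2)
    (x : AddMonoidAlgebra ℤ V) :
    ch χ (AddMonoidAlgebra.mapDomainRingHom ℤ g x) = ch (χ.comp g) x := by
  have h : ((ch χ : AddMonoidAlgebra ℤ W →+* ℤ).comp (AddMonoidAlgebra.mapDomainRingHom ℤ g)) =
      (ch (χ.comp g) : AddMonoidAlgebra ℤ V →+* ℤ) := by
    refine AddMonoidAlgebra.ringHom_ext (fun r => by simp [ch]) fun v => ?_
    change ch χ (AddMonoidAlgebra.mapDomain g (.single v 1)) = _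
    rw [AddMonoidAlgebra.mapDomain_single, ch_single]
    exact (ch_single (χ.comp g) v).symm
  exact congrArg (fun k => k x) h

theorem two_dvd_ch (χ : V →+ ZMod 2) {x : AddMonoidAlgebra ℤ V} (hx : x ∈ augIdeal ℤ V) :
    2 ∣ ch χ x := by
  refine Ideal.mem_span_singleton.1 ((Submodule.span_le.2 ?_ : Submodule.span ℤ (Set.range gen) ≤
    ((Ideal.span {(2 : ℤ)}).restrictScalars ℤ).comap (ch χ).toLinearMap) (augIdeal_le_span hx))
  rintro _ ⟨v, rfl⟩
  refine Ideal.mem_span_singleton.2 (?_ : 2 ∣ ch χ (gen v))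
  rw [ch_gen, neg_mul]
  exact (Dvd.intro _ rfl).neg_right

theorem two_pow_dvd_ch (χ : V →+ ZMod 2) {n : ℕ} {x : AddMonoidAlgebra ℤ V}
    (hx : x ∈ augIdeal ℤ V ^ n) : 2 ^ n ∣ ch χ x := by
  have h1 : augIdeal ℤ V ≤ (Ideal.span {2}).comap (ch χ) := fun y hy =>
    Ideal.mem_span_singleton.2 (two_dvd_ch χ hy)
  have h2 := Ideal.le_comap_pow (ch χ) n (Ideal.pow_right_mono h1 n hx)
  rw [Ideal.mem_comap, Ideal.span_singleton_pow] at h2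
  exact Ideal.mem_span_singleton.1 h2

theorem gen_mul_self [Module (ZMod 2) V] (v : V) : gen v * gen v = -2 * gen v := by
  have h : AddMonoidAlgebra.single v (1 : ℤ) * .single v 1 = 1 := by
    rw [AddMonoidAlgebra.single_mul_single, ZModModule.add_self, mul_one]; rfl
  rw [gen]
  linear_combination h

theorem gen_pow_mul [Module (ZMod 2) V] (v : V) (m : ℕ) : gen v ^ m * gen v = (-2) ^ m * gen v := by
  induction m with
  | zero => simp
  | succ m ih => rw [pow_succ, mul_assoc, gen_mul_self, mul_left_comm, ih]; ring

/-! ### The powers of the augmentation ideal in terms of characters -/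

theorem zmod_two_eq_ite (a : ZMod 2) : a = if a ≠ 0 then 1 else 0 := by
  revert a; decide

variable {ι : Type*}

/-- The product of the elements `[b i] - 1`, for `i ∈ S`. For a basis `b` of `V`, these products
form a `ℤ`-basis of `ℤ[V]`. -/
def monom (b : ι → V) (S : Finset ι) : AddMonoidAlgebra ℤ V := ∏ i ∈ S, gen (b i)

theorem monom_mem (b : ι → V) (S : Finset ι) : monom b S ∈ augIdeal ℤ V ^ S.card := by
  have h := Ideal.prod_mem_prod (s := S) (I := fun _ => augIdeal ℤ V) (x := fun i => gen (b i))
    (fun i _ => gen_mem (b i))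
  rwa [Finset.prod_const] at h

theorem gen_pow_mul_monom [Module (ZMod 2) V] [DecidableEq ι] (b : ι → V) {S : Finset ι} {i : ι}
    (hi : i ∈ S) (m : ℕ) :
    gen (b i) ^ m * monom b S = (-2) ^ m * monom b S := by
  rw [monom, ← Finset.mul_prod_erase S _ hi, ← mul_assoc, gen_pow_mul, mul_assoc]

/-- Each factor `2` raises the power of the augmentation ideal by one, since
`-2 ([v] - 1) = ([v] - 1)²`. -/
theorem two_pow_mul_monom_mem [Module (ZMod 2) V] (b : ι → V) {S : Finset ι}
    (hS : S.Nonempty) (m : ℕ) :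
    2 ^ m * monom b S ∈ augIdeal ℤ V ^ (m + S.card) := by
  classical
  obtain ⟨i, hi⟩ := hS
  have h := Ideal.mul_mem_mul (Ideal.pow_mem_pow (gen_mem (b i)) m) (monom_mem b S)
  rw [gen_pow_mul_monom b hi, ← pow_add, neg_pow, mul_assoc] at h
  have h2 := Ideal.mul_mem_left _ ((-1) ^ m) h
  rwa [← mul_assoc, ← mul_pow, neg_one_mul, neg_neg, one_pow, one_mul] at h2

variable [Module (ZMod 2) V] (b : Module.Basis ι (ZMod 2) V)

/-- The linear form that takes the value `1` on the basis vectors `b i` with `i ∈ S`, and `0` on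
the others. -/
def dualInd (S : Finset ι) : Module.Dual (ZMod 2) V := ∑ i ∈ S, b.coord i

theorem dualInd_apply [DecidableEq ι] (S : Finset ι) (i : ι) :
    dualInd b S (b i) = if i ∈ S then 1 else 0 := by
  simp [dualInd, Finsupp.single_apply]

theorem eq_dualInd [Fintype ι] [DecidableEq ι] (χ : Module.Dual (ZMod 2) V) :
    χ = dualInd b {i | χ (b i) ≠ 0} := by
  refine b.ext fun i => ?_
  rw [dualInd_apply]
  simpa using zmod_two_eq_ite (χ (b i))

theorem eq_sum_basis [Fintype ι] (v : V) : v = ∑ i with b.repr v i ≠ 0, b i := by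
  classical
  conv_lhs => rw [← b.sum_repr v]
  rw [Finset.sum_filter]
  refine Finset.sum_congr rfl fun i _ => ?_
  generalize b.repr v i = a
  revert a
  have : ∀ a : ZMod 2, a = 0 ∨ a = 1 := by decide
  intro a
  rcases this a with rfl | rfl <;> simp

theorem mem_span_monom [Fintype ι] (x : AddMonoidAlgebra ℤ V) :
    x ∈ Submodule.span ℤ (Set.range (monom b)) := by
  classical
  induction x using AddMonoidAlgebra.induction_linear with
  | zero => simp
  | add x y hx hy => exact add_mem hx hy
  | single v r =>
    have h1 : AddMonoidAlgebra.single v r = r • AddMonoidAlgebra.single v (1 : ℤ) := by simp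
    have h2 : ∀ S : Finset ι, AddMonoidAlgebra.single (∑ i ∈ S, b i) (1 : ℤ) =
        ∏ i ∈ S, (1 + gen (b i)) := by
      intro S
      induction S using Finset.induction_on with
      | empty => simp [AddMonoidAlgebra.one_def]
      | insert i S hi ih =>
        rw [Finset.sum_insert hi, Finset.prod_insert hi, ← ih, gen, add_sub_cancel,
          AddMonoidAlgebra.single_mul_single, mul_one]
    rw [h1, eq_sum_basis b v, h2, Finset.prod_one_add]
    exact Submodule.smul_mem _ _ (Submodule.sum_mem _ fun T _ => Submodule.subset_span ⟨T, rfl⟩)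

theorem ch_dualInd_monom [DecidableEq ι] (S T : Finset ι) :
    ch (dualInd b S : V →+ ZMod 2) (monom b T) = if T ⊆ S then (-2) ^ T.card else 0 := by
  rw [monom, map_prod]
  split_ifs with h
  · rw [← Finset.prod_const]
    refine Finset.prod_congr rfl fun i hi => ?_
    rw [ch_gen]
    simp [dualInd_apply, h hi, ZMod.val_one]
  · obtain ⟨i, hi, hiS⟩ := Finset.not_subset.1 h
    refine Finset.prod_eq_zero hi ?_
    rw [ch_gen]
    simp [dualInd_apply, hiS]

end Algebra

section Finite

variable {V : Type u} [AddCommGroup V] [Module (ZMod 2) V] [Module.Finite (ZMod 2) V]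

/-- The powers of the augmentation ideal are detected by the characters. In the expansion
`x = ∑ a_S ∏_{i ∈ S} ([b i] - 1)`, the numbers `a_S (-2)^|S|` are obtained from the values of the
characters by Möbius inversion, hence they are divisible by `2ⁿ`. -/
theorem mem_augIdeal_pow_iff {n : ℕ} (hn : 0 < n) (x : AddMonoidAlgebra ℤ V) :
    x ∈ augIdeal ℤ V ^ n ↔
      x ∈ augIdeal ℤ V ∧ ∀ χ : Module.Dual (ZMod 2) V, 2 ^ n ∣ ch (χ : V →+ ZMod 2) x := by
  classical
  refine ⟨fun hx => ⟨Ideal.pow_le_self hn.ne' hx, fun χ => two_pow_dvd_ch _ hx⟩, ?_⟩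
  rintro ⟨hx, hdvd⟩
  let b := Module.finBasis (ZMod 2) V
  obtain ⟨a, rfl⟩ := (Submodule.mem_span_range_iff_exists_fun ℤ).1 (mem_span_monom b x)
  have hch : ∀ S, ch (dualInd b S : V →+ ZMod 2) (∑ T, a T • monom b T) =
      ∑ T ∈ S.powerset, a T * (-2) ^ T.card := by
    intro S
    simp only [map_sum, map_zsmul, ch_dualInd_monom, smul_eq_mul, mul_ite, mul_zero]
    rw [← Finset.sum_filter]
    refine Finset.sum_congr ?_ fun _ _ => rfl
    ext T
    simp
  -- The coefficient of the empty product is the augmentation of the element.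
  have h0 : a ∅ = 0 := by
    have h1 := hch ∅
    have h2 : ((dualInd b ∅ : Module.Dual (ZMod 2) V) : V →+ ZMod 2) = 0 := by
      ext v
      simp [dualInd]
    rw [h2, ch_zero, show aug ℤ V _ = 0 from hx] at h1
    simpa using h1.symm
  -- The value at `dualInd b S` is `a S * (-2) ^ #S` plus the terms of the proper subsets of `S`.
  have hS : ∀ S, 2 ^ n ∣ a S * (-2) ^ S.card := by
    intro S
    induction S using Finset.strongInduction with
    | H S ih =>
      have h1 := hdvd (dualInd b S)
      rw [hch, ← Finset.sum_erase_add _ _ (Finset.mem_powerset_self S)] at h1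
      refine (dvd_add_right (Finset.dvd_sum fun T hT => ih T ?_)).1 h1
      rw [Finset.mem_erase, Finset.mem_powerset] at hT
      exact hT.2.ssubset_of_ne hT.1
  refine Submodule.sum_mem _ fun S _ => ?_
  rcases S.eq_empty_or_nonempty with rfl | hne
  · simp [h0]
  have h1 : (2 : ℤ) ^ (n - S.card) ∣ a S := by
    rcases le_total n S.card with h | h
    · simp [Nat.sub_eq_zero_of_le h]
    · have h2 := hS S
      rw [neg_pow, mul_left_comm, (isUnit_one.neg.pow _).dvd_mul_left] at h2
      rw [← Nat.sub_add_cancel h, pow_add] at h2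
      exact Int.dvd_of_mul_dvd_mul_right (by positivity) h2
  obtain ⟨c, hc⟩ := h1
  have h2 : a S • monom b S = (c : AddMonoidAlgebra ℤ V) * (2 ^ (n - S.card) * monom b S) := by
    rw [hc, zsmul_eq_mul]
    push_cast
    ring
  rw [h2]
  exact Ideal.mul_mem_left _ _
    (Ideal.pow_le_pow_right (by omega) (two_pow_mul_monom_mem b hne _))

theorem two_smul_mem {n : ℕ} (hn : 0 < n) {x : AddMonoidAlgebra ℤ V}
    (hx : x ∈ augIdeal ℤ V ^ n) : (2 : ℤ) • x ∈ augIdeal ℤ V ^ (n + 1) := by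
  rw [mem_augIdeal_pow_iff hn] at hx
  rw [mem_augIdeal_pow_iff n.succ_pos]
  refine ⟨zsmul_mem hx.1 2, fun χ => ?_⟩
  rw [map_zsmul, smul_eq_mul, pow_succ']
  exact mul_dvd_mul_left 2 (hx.2 χ)

theorem mem_of_two_smul_mem {n : ℕ} (hn : 0 < n) {x : AddMonoidAlgebra ℤ V}
    (hx : (2 : ℤ) • x ∈ augIdeal ℤ V ^ (n + 1)) : x ∈ augIdeal ℤ V ^ n := by
  rw [mem_augIdeal_pow_iff n.succ_pos] at hx
  rw [mem_augIdeal_pow_iff hn]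
  constructor
  · have h : aug ℤ V ((2 : ℤ) • x) = 0 := hx.1
    rw [map_zsmul, smul_eq_zero] at h
    exact h.resolve_left two_ne_zero
  · intro χ
    have h := hx.2 χ
    rw [map_zsmul, smul_eq_mul, pow_succ'] at h
    exact Int.dvd_of_mul_dvd_mul_left two_ne_zero h

end Finite

/-! ### The kernels of the iterated diagonals -/

section Diagonal

variable {A : Type u} [AddCommGroup A]

/-- Evaluation of functions at `y`. -/
def evalAt (y : A) : redFun A →ₗ[ZMod 2] ZMod 2 := LinearMap.proj y ∘ₗ (redFun A).subtype

/-- The reduced difference operator, `(crossDiff y f)(x) = f (x + y) - f x - f y`. -/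
def crossDiff (y : A) (f : redFun A) : redFun A :=
  ⟨fun x => f.1 (x + y) - f.1 x - f.1 y, by
    have h : f.1 0 = 0 := f.2
    change f.1 (0 + y) - f.1 0 - f.1 y = 0
    rw [zero_add, h, sub_zero, sub_self]⟩

theorem crossDiff_apply (y : A) (f : redFun A) (x : A) :
    (crossDiff y f).1 x = f.1 (x + y) - f.1 x - f.1 y := rfl

/-- Contraction of the right factor `Ī` of a tensor product by evaluation at `y`. -/
def contract (M : Type u) [AddCommGroup M] [Module (ZMod 2) M] (y : A) :
    M ⊗[ZMod 2] redFun A →ₗ[ZMod 2] M :=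
  (TensorProduct.rid (ZMod 2) M).toLinearMap ∘ₗ TensorProduct.map LinearMap.id (evalAt y)

theorem contract_tmul (M : Type u) [AddCommGroup M] [Module (ZMod 2) M] (y : A) (m : M)
    (f : redFun A) : contract M y (m ⊗ₜ f) = f.1 y • m := by
  simp [contract, evalAt]

theorem contract_map {M N : Type u} [AddCommGroup M] [Module (ZMod 2) M] [AddCommGroup N]
    [Module (ZMod 2) N] (L : M →ₗ[ZMod 2] N) (y : A) (t : M ⊗[ZMod 2] redFun A) :
    contract N y (TensorProduct.map L LinearMap.id t) = L (contract M y t) := by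
  induction t with
  | zero => simp
  | tmul m f => simp [contract_tmul]
  | add s t hs ht => simp only [map_add, hs, ht]

/-- As `A` is finite, an element of `M ⊗ Ī` is determined by its contractions. -/
theorem eq_zero_of_contract [Finite A] (M : Type u) [AddCommGroup M] [Module (ZMod 2) M]
    (t : M ⊗[ZMod 2] redFun A) (ht : ∀ y, contract M y t = 0) : t = 0 := by
  classical
  let _ := Fintype.ofFinite A
  have h1 : ∀ t y, TensorProduct.piScalarRight (ZMod 2) (ZMod 2) M A
      ((redFun A).subtype.lTensor M t) y = contract M y t := by
    intro t y
    induction t with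
    | zero => simp
    | tmul m f => simp [contract_tmul]
    | add s t hs ht => simp only [map_add, Pi.add_apply, hs, ht]
  apply Module.Flat.lTensor_preserves_injective_linearMap (M := M) (redFun A).subtype
    (redFun A).injective_subtype
  apply (TensorProduct.piScalarRight (ZMod 2) (ZMod 2) M A).injective
  ext y
  rw [h1, ht, map_zero, map_zero, Pi.zero_apply]

theorem contract_redDiag [Finite A] (y : A) (f : redFun A) :
    contract (redFun A) y (redDiag A f) = crossDiff y f := by
  classical
  have h1 : ∀ t x, (contract (redFun A) y (TensorProduct.map (toRedFun A) (toRedFun A) t)).1 x =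
      letI := Fintype.ofFinite A
      TensorProduct.piScalarRight (ZMod 2) (ZMod 2) (A → ZMod 2) A t y x -
        TensorProduct.piScalarRight (ZMod 2) (ZMod 2) (A → ZMod 2) A t 0 x -
        (TensorProduct.piScalarRight (ZMod 2) (ZMod 2) (A → ZMod 2) A t y 0 -
        TensorProduct.piScalarRight (ZMod 2) (ZMod 2) (A → ZMod 2) A t 0 0) := by
    intro t x
    induction t with
    | zero => simp
    | tmul a b =>
      simp only [TensorProduct.map_tmul, contract_tmul, toRedFun, LinearMap.coe_mk, AddHom.coe_mk,
        TensorProduct.piScalarRight_apply, TensorProduct.piScalarRightHom_tmul,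
        Submodule.coe_smul, Pi.smul_apply, smul_eq_mul]
      ring
    | add s t hs ht =>
      simp only [map_add, Pi.add_apply, Submodule.coe_add, hs, ht]
      ring
  refine Subtype.ext (funext fun x => ?_)
  have h0 : f.1 0 = 0 := f.2
  refine (h1 _ x).trans ?_
  simp [funDiag, crossDiff_apply, h0]

/-- The functions in the kernel of `Δ^{(k+1)}`: the reduced polynomial functions of degree at most
`k`. -/
abbrev polyFun (A : Type u) [AddCommGroup A] [Finite A] (k : ℕ) : Submodule (ZMod 2) (redFun A) :=
  LinearMap.ker (iterDiag A k)

theorem mem_polyFun_zero [Finite A] (f : redFun A) : f ∈ polyFun A 0 ↔ f = 0 := Iff.rfl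

theorem mem_polyFun_succ [Finite A] (k : ℕ) (f : redFun A) :
    f ∈ polyFun A (k + 1) ↔ ∀ y, crossDiff y f ∈ polyFun A k := by
  have h : ∀ y, iterDiag A k (crossDiff y f) = contract _ y (iterDiag A (k + 1) f) := by
    intro y
    rw [← contract_redDiag, ← contract_map]
    rfl
  simp only [LinearMap.mem_ker]
  constructor
  · intro hf y
    rw [h, hf]
    exact map_zero (contract _ y)
  · intro hf
    exact eq_zero_of_contract _ _ fun y => (h y).symm.trans (hf y)

theorem polyFun_le_succ [Finite A] (k : ℕ) : polyFun A k ≤ polyFun A (k + 1) := by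
  induction k with
  | zero =>
    intro f hf
    rw [mem_polyFun_zero] at hf
    rw [hf]
    exact zero_mem _
  | succ k ih =>
    intro f hf
    rw [mem_polyFun_succ] at hf ⊢
    exact fun y => ih (hf y)

/-- An additive map, as a function that vanishes at `0`. -/
def linFun (v : A →+ ZMod 2) : redFun A := ⟨v, v.map_zero⟩

theorem linFun_mem [Finite A] (v : A →+ ZMod 2) : linFun v ∈ polyFun A 1 := by
  rw [mem_polyFun_succ]
  intro y
  rw [mem_polyFun_zero]
  refine Subtype.ext (funext fun x => ?_)
  rw [crossDiff_apply]
  simp [linFun]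

theorem linFun_mem_succ [Finite A] (v : A →+ ZMod 2) (k : ℕ) : linFun v ∈ polyFun A (k + 1) := by
  induction k with
  | zero => exact linFun_mem v
  | succ k ih => exact polyFun_le_succ _ ih

/-- The product of a function that vanishes at `0` with an additive map. -/
def mulLin (v : A →+ ZMod 2) (f : redFun A) : redFun A := ⟨fun x => f.1 x * v x, by
  change f.1 0 * v 0 = 0
  rw [map_zero, mul_zero]⟩

theorem crossDiff_mulLin (v : A →+ ZMod 2) (y : A) (f : redFun A) :
    crossDiff y (mulLin v f) =
      mulLin v (crossDiff y f) + v y • crossDiff y f + v y • f + f.1 y • linFun v := by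
  refine Subtype.ext (funext fun x => ?_)
  simp only [crossDiff_apply, mulLin, linFun, map_add, Submodule.coe_add, Submodule.coe_smul,
    Pi.add_apply, Pi.smul_apply, smul_eq_mul]
  ring

theorem mulLin_mem [Finite A] (v : A →+ ZMod 2) {k : ℕ} {f : redFun A} (hf : f ∈ polyFun A k) :
    mulLin v f ∈ polyFun A (k + 1) := by
  induction k generalizing f with
  | zero =>
    rw [mem_polyFun_zero] at hf
    have h : mulLin v f = 0 := by
      refine Subtype.ext (funext fun x => ?_)
      simp [mulLin, hf]
    rw [h]
    exact zero_mem _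
  | succ k ih =>
    rw [mem_polyFun_succ]
    intro y
    have hD := (mem_polyFun_succ k f).1 hf y
    rw [crossDiff_mulLin]
    exact add_mem (add_mem (add_mem (ih hD) (Submodule.smul_mem _ _ (polyFun_le_succ _ hD)))
      (Submodule.smul_mem _ _ hf)) (Submodule.smul_mem _ _ (linFun_mem_succ v k))

/-- The cross effects with more than `k` arguments of a polynomial function of degree at most `k`
vanish. -/
theorem sum_powerset_eq_zero [Finite A] {ι : Type*} [DecidableEq ι] (e : ι → A) {k : ℕ}
    {f : redFun A} (hf : f ∈ polyFun A k) {S : Finset ι} (hS : k < S.card) :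
    ∑ T ∈ S.powerset, f.1 (∑ i ∈ T, e i) = 0 := by
  induction k generalizing f S with
  | zero =>
    rw [mem_polyFun_zero] at hf
    simp [hf]
  | succ k ih =>
    obtain ⟨i, hi⟩ := Finset.card_pos.1 (k.succ_pos.trans hS)
    have hcard : k < (S.erase i).card := by
      rw [Finset.card_erase_of_mem hi]
      omega
    have h := ih ((mem_polyFun_succ k f).1 hf (e i)) hcard
    -- The constant terms cancel because the number of subsets of `S.erase i` is even.
    have hconst : ∑ T ∈ (S.erase i).powerset, f.1 (e i) = 0 := by
      have h2 : ((2 : ℕ) : ZMod 2) = 0 := rfl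
      rw [Finset.sum_const, Finset.card_powerset, nsmul_eq_mul, Nat.cast_pow, h2,
        zero_pow (by omega), zero_mul]
    rw [← Finset.insert_erase hi, Finset.sum_powerset_insert (Finset.notMem_erase i S),
      ← Finset.sum_add_distrib]
    simp only [crossDiff_apply, Finset.sum_sub_distrib, hconst, sub_zero] at h
    rw [Finset.sum_add_distrib, add_comm, ← CharTwo.sub_eq_add, ← h]
    congr 1
    refine Finset.sum_congr rfl fun T hT => ?_
    rw [Finset.sum_insert fun hiT => Finset.notMem_erase i S (Finset.mem_powerset.1 hT hiT),
      add_comm]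

/-- Möbius inversion for functions on the subsets of a finite set, in characteristic two. -/
theorem sum_powerset_sum_powerset {ι : Type*} [DecidableEq ι] (g : Finset ι → ZMod 2)
    (U : Finset ι) : ∑ S ∈ U.powerset, ∑ T ∈ S.powerset, g T = g U := by
  induction U using Finset.induction_on generalizing g with
  | empty => simp
  | insert i U hi ih =>
    have h : ∀ S ∈ U.powerset, ∑ T ∈ (insert i S).powerset, g T =
        ∑ T ∈ S.powerset, g T + ∑ T ∈ S.powerset, g (insert i T) := fun S hS =>
      Finset.sum_powerset_insert (fun hiS => hi (Finset.mem_powerset.1 hS hiS)) g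
    rw [Finset.sum_powerset_insert hi, Finset.sum_congr rfl h, Finset.sum_add_distrib, ← add_assoc,
      CharTwo.add_self_eq_zero, zero_add]
    exact ih fun T => g (insert i T)

end Diagonal

/-! ### The leading coefficients of the values of the characters -/

section Leading

variable {V : Type u} [AddCommGroup V]

theorem ch_prod_gen {ι : Type*} (χ : V →+ ZMod 2) (v : ι → V) (S : Finset ι) :
    ch χ (∏ i ∈ S, gen (v i)) = (-2) ^ S.card * ∏ i ∈ S, ((χ (v i)).val : ℤ) := by
  simp only [map_prod, ch_gen, Finset.prod_mul_distrib, Finset.prod_const]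

theorem prod_gen_mem {n : ℕ} (v : Fin n → V) : ∏ i, gen (v i) ∈ augIdeal ℤ V ^ n := by
  have h := Ideal.prod_mem_prod (s := Finset.univ) (I := fun _ : Fin n => augIdeal ℤ V)
    (x := fun i => gen (v i)) (fun i _ => gen_mem (v i))
  simpa using h

/-- The element `∏ ([v i] - 1)` of the `n`-th power of the augmentation ideal. -/
def prodGen {n : ℕ} (v : Fin n → V) : (augIdeal ℤ V ^ n).toAddSubgroup := ⟨_, prod_gen_mem v⟩

/-- Two additive maps on a positive power of the augmentation ideal agree if they agree on the
products of elements `[v] - 1`. -/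
theorem hom_ext_prodGen {M : Type*} [AddCommGroup M] {n : ℕ} (hn : 0 < n)
    {f g : (augIdeal ℤ V ^ n).toAddSubgroup →+ M} (h : ∀ v, f (prodGen v) = g (prodGen v)) :
    f = g := by
  have key : ∀ x ∈ Submodule.span ℤ (Set.range fun v : Fin n → V => ∏ i, gen (v i)),
      ∃ hx : x ∈ augIdeal ℤ V ^ n, f ⟨x, hx⟩ = g ⟨x, hx⟩ := by
    intro x hx
    induction hx using Submodule.span_induction with
    | mem x hx =>
      obtain ⟨v, rfl⟩ := hx
      exact ⟨prod_gen_mem v, h v⟩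
    | zero => exact ⟨zero_mem _, (map_zero f).trans (map_zero g).symm⟩
    | add x y _ _ hx hy =>
      obtain ⟨hx, ex⟩ := hx
      obtain ⟨hy, ey⟩ := hy
      refine ⟨add_mem hx hy, ?_⟩
      have e := congrArg₂ (· + ·) ex ey
      simp only [← map_add] at e
      exact e
    | smul r x _ hx =>
      obtain ⟨hx, ex⟩ := hx
      refine ⟨zsmul_mem hx r, ?_⟩
      have e := congrArg (r • ·) ex
      simp only [← map_zsmul] at e
      exact e
  ext ⟨x, hx⟩
  exact (key x (augIdeal_pow_le_span hn hx)).2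

variable [Module (ZMod 2) V]

/-- The map `I(V)ⁿ → Ī(V)`, which sends `x` to the function `χ ↦ ch χ x / 2ⁿ mod 2`. The integer
division is exact by `two_pow_dvd_ch`; the function vanishes at `χ = 0` because `ch 0` is the
augmentation and `n` is positive. -/
def leading {n : ℕ} (hn : 0 < n) :
    (augIdeal ℤ V ^ n).toAddSubgroup →+ redFun (Module.Dual (ZMod 2) V) where
  toFun x := ⟨fun χ => ((ch (χ : V →+ ZMod 2) x.1 / 2 ^ n : ℤ) : ZMod 2), by
    have h : ch (((0 : Module.Dual (ZMod 2) V) : V →ₗ[ZMod 2] ZMod 2) : V →+ ZMod 2) x.1 = 0 :=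
      (ch_zero x.1).trans (Ideal.pow_le_self hn.ne' x.2)
    change ((ch (((0 : Module.Dual (ZMod 2) V) : V →ₗ[ZMod 2] ZMod 2) : V →+ ZMod 2) x.1 /
      2 ^ n : ℤ) : ZMod 2) = 0
    rw [h, Int.zero_ediv, Int.cast_zero]⟩
  map_zero' := Subtype.ext (funext fun χ => by simp)
  map_add' x y := Subtype.ext (funext fun χ => by
    change ((ch (χ : V →+ ZMod 2) (x.1 + y.1) / 2 ^ n : ℤ) : ZMod 2) =
      ((ch (χ : V →+ ZMod 2) x.1 / 2 ^ n : ℤ) : ZMod 2) +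
      ((ch (χ : V →+ ZMod 2) y.1 / 2 ^ n : ℤ) : ZMod 2)
    rw [map_add, Int.add_ediv_of_dvd_left (two_pow_dvd_ch _ x.2), Int.cast_add])

theorem leading_apply {n : ℕ} (hn : 0 < n) (x : (augIdeal ℤ V ^ n).toAddSubgroup)
    (χ : Module.Dual (ZMod 2) V) :
    (leading hn x).1 χ = ((ch (χ : V →+ ZMod 2) x.1 / 2 ^ n : ℤ) : ZMod 2) := rfl

theorem leading_eq_of_ch {n : ℕ} (hn : 0 < n) (x : (augIdeal ℤ V ^ n).toAddSubgroup)
    (χ : Module.Dual (ZMod 2) V) {c : ℤ} (h : ch (χ : V →+ ZMod 2) x.1 = (-2) ^ n * c) :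
    (leading hn x).1 χ = c := by
  rw [leading_apply, h, neg_pow, mul_right_comm, Int.mul_ediv_cancel _ (by positivity)]
  push_cast
  rw [CharTwo.neg_eq, one_pow, one_mul]

theorem leading_eq_zero_iff [Module.Finite (ZMod 2) V] {n : ℕ} (hn : 0 < n)
    (x : (augIdeal ℤ V ^ n).toAddSubgroup) :
    leading hn x = 0 ↔ x.1 ∈ augIdeal ℤ V ^ (n + 1) := by
  rw [mem_augIdeal_pow_iff n.succ_pos, and_iff_right (Ideal.pow_le_self hn.ne' x.2),
    Subtype.ext_iff, funext_iff]
  refine forall_congr' fun χ => ?_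
  rw [leading_apply, pow_succ, Int.mul_comm (2 ^ n) 2]
  change _ = 0 ↔ _
  rw [ZMod.intCast_zmod_eq_zero_iff_dvd]
  obtain ⟨c, hc⟩ := two_pow_dvd_ch (χ : V →+ ZMod 2) x.2
  rw [hc, Int.mul_ediv_cancel_left _ (by positivity), mul_comm 2,
    Int.mul_dvd_mul_iff_left (by positivity)]
  rfl

theorem leading_prodGen {n : ℕ} (hn : 0 < n) (v : Fin n → V) (χ : Module.Dual (ZMod 2) V) :
    (leading hn (prodGen v)).1 χ = ∏ i, χ (v i) := by
  rw [leading_eq_of_ch hn (prodGen v) χ (c := ∏ i, ((χ (v i)).val : ℤ))]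
  · simp
  · change ch (χ : V →+ ZMod 2) (∏ i, gen (v i)) = _
    rw [ch_prod_gen, Finset.card_univ, Fintype.card_fin]
    rfl

variable [Module.Finite (ZMod 2) V]

instance finite_dual_of_finite : Finite (Module.Dual (ZMod 2) V) :=
  Module.finite_of_finite (ZMod 2)

theorem leading_prodGen_mem {n : ℕ} (hn : 0 < n) (v : Fin n → V) :
    leading hn (prodGen v) ∈ polyFun (Module.Dual (ZMod 2) V) n := by
  induction n, hn using Nat.le_induction with
  | base =>
    convert linFun_mem (Module.Dual.eval (ZMod 2) V (v 0)).toAddMonoidHom using 1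
    refine Subtype.ext (funext fun χ => ?_)
    rw [leading_prodGen]
    simp [linFun]
  | succ n hn ih =>
    convert mulLin_mem (Module.Dual.eval (ZMod 2) V (v (Fin.last n))).toAddMonoidHom
      (ih fun i => v i.castSucc) using 1
    refine Subtype.ext (funext fun χ => ?_)
    rw [leading_prodGen, Fin.prod_univ_castSucc]
    simp [mulLin, leading_prodGen]

theorem leading_mem {n : ℕ} (hn : 0 < n) (x : (augIdeal ℤ V ^ n).toAddSubgroup) :
    leading hn x ∈ polyFun (Module.Dual (ZMod 2) V) n := by
  have h : (polyFun (Module.Dual (ZMod 2) V) n).mkQ.toAddMonoidHom.comp (leading hn) = 0 :=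
    hom_ext_prodGen hn fun v =>
      (Submodule.Quotient.mk_eq_zero _).2 (leading_prodGen_mem hn v)
  exact (Submodule.Quotient.mk_eq_zero _).1 (DFunLike.congr_fun h x)

/-- Every reduced polynomial function of degree at most `n` is a leading coefficient: it is a sum of
monomials of degrees between `1` and `n` in dual coordinates, and such a monomial is attained at a
product of elements `[b i] - 1`, with one factor repeated. -/
theorem exists_leading_eq {n : ℕ} (hn : 0 < n) {f : redFun (Module.Dual (ZMod 2) V)}
    (hf : f ∈ polyFun (Module.Dual (ZMod 2) V) n) : ∃ x, leading hn x = f := by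
  classical
  let b := Module.finBasis (ZMod 2) V
  let a : Finset (Fin (Module.finrank (ZMod 2) V)) → ZMod 2 := fun S =>
    ∑ T ∈ S.powerset, f.1 (dualInd b T)
  -- `a S` is the coefficient of the monomial `∏ i ∈ S, χ (b i)` in `f`.
  have ha : ∀ S, ∃ x, ∀ χ, (leading hn x).1 χ = a S * ∏ i ∈ S, χ (b i) := by
    intro S
    have hzero : a S = 0 → ∃ x, ∀ χ, (leading hn x).1 χ = a S * ∏ i ∈ S, χ (b i) := fun h =>
      ⟨0, fun χ => by simp [h]⟩
    rcases S.eq_empty_or_nonempty with rfl | ⟨i, hi⟩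
    · refine hzero ?_
      have h0 : f.1 0 = 0 := f.2
      simpa [a, dualInd] using h0
    rcases lt_or_ge n S.card with hlt | hle
    · exact hzero (sum_powerset_eq_zero (fun i => b.coord i) hf hlt)
    by_cases h1 : a S = 0
    · exact hzero h1
    have h1 : a S = 1 := by simpa [h1] using zmod_two_eq_ite (a S)
    have hmem : gen (b i) ^ (n - S.card) * monom b S ∈ augIdeal ℤ V ^ n := by
      have h := Ideal.mul_mem_mul (Ideal.pow_mem_pow (gen_mem (b i)) (n - S.card)) (monom_mem b S)
      rwa [← pow_add, Nat.sub_add_cancel hle] at h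
    refine ⟨⟨_, hmem⟩, fun χ => ?_⟩
    rw [leading_eq_of_ch hn _ χ (c := ∏ i ∈ S, ((χ (b i)).val : ℤ)), h1, one_mul]
    · simp
    · have h2 : (-2 : ℤ) ^ n = (-2) ^ (n - S.card) * (-2) ^ S.card := by
        rw [← pow_add, Nat.sub_add_cancel hle]
      change ch (χ : V →+ ZMod 2) (gen (b i) ^ (n - S.card) * monom b S) = _
      rw [gen_pow_mul_monom b hi, map_mul, monom, ch_prod_gen, h2, mul_assoc, map_pow, map_neg,
        map_ofNat]
      simp
  choose x hx using ha
  refine ⟨∑ S, x S, Subtype.ext (funext fun χ => ?_)⟩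
  have h1 : (leading hn (∑ S, x S)).1 χ = ∑ S, (leading hn (x S)).1 χ := by
    rw [map_sum]
    simp
  rw [h1]
  simp only [hx]
  have h2 := sum_powerset_sum_powerset (fun T => f.1 (dualInd b T))
    ({i | χ (b i) ≠ 0} : Finset (Fin (Module.finrank (ZMod 2) V)))
  rw [← eq_dualInd b χ] at h2
  rw [← h2, ← Finset.sum_subset (Finset.subset_univ _)]
  · refine Finset.sum_congr rfl fun S hS => ?_
    rw [Finset.prod_eq_one, mul_one]
    intro i hi
    have h3 := Finset.mem_powerset.1 hS hi
    rw [zmod_two_eq_ite (χ (b i)), if_pos (by simpa using h3)]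
  · intro S _ hS
    rw [Finset.mem_powerset, Finset.not_subset] at hS
    obtain ⟨i, hi, hiS⟩ := hS
    rw [Finset.prod_eq_zero hi (by simpa using hiS), mul_zero]

end Leading

/-! ### Exactness of sequences of functors -/

/-- Evaluation at an object preserves homology, so exactness can be checked on elements of the
values. -/
theorem exact_of_forall {S : ShortComplex FA.{u}}
    (h : ∀ (V : Vf.{u}) (x : S.X₂.obj V), (S.g.app V).hom x = 0 →
      ∃ y : S.X₁.obj V, (S.f.app V).hom y = x) : S.Exact := by
  rw [ShortComplex.exact_iff_isZero_homology]
  refine Functor.isZero _ fun V => ?_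
  have hV : (S.map ((evaluation Vf.{u} AddCommGrpCat.{u}).obj V)).Exact := by
    rw [ShortComplex.ab_exact_iff]
    exact h V
  exact ((ShortComplex.exact_iff_isZero_homology _).1 hV).of_iso
    (S.mapHomologyIso ((evaluation Vf.{u} AddCommGrpCat.{u}).obj V)).symm

theorem mono_of_injective {F G : FA.{u}} (α : F ⟶ G)
    (h : ∀ V, Function.Injective (α.app V).hom) : Mono α := by
  have : ∀ V, Mono (α.app V) := fun V => (AddCommGrpCat.mono_iff_injective _).2 (h V)
  exact NatTrans.mono_of_mono_app α

theorem epi_of_surjective {F G : FA.{u}} (α : F ⟶ G)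
    (h : ∀ V, Function.Surjective (α.app V).hom) : Epi α := by
  have : ∀ V, Epi (α.app V) := fun V => (AddCommGrpCat.epi_iff_surjective _).2 (h V)
  exact NatTrans.epi_of_epi_app α

/-! ### Reduction modulo two -/

section Reduction

variable {V : Type u} [AddCommGroup V]

theorem redHom_surjective : Function.Surjective (redHom V) := by
  intro y
  induction y using AddMonoidAlgebra.induction_linear with
  | zero => exact ⟨0, map_zero _⟩
  | add x y hx hy =>
    obtain ⟨a, rfl⟩ := hx
    obtain ⟨b, rfl⟩ := hy
    exact ⟨a + b, map_add _ a b⟩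
  | single v r =>
    obtain ⟨m, rfl⟩ := ZMod.intCast_surjective r
    exact ⟨.single v m, by simp [redHom]⟩

theorem exists_two_smul_of_redHom_eq_zero {x : AddMonoidAlgebra ℤ V} (hx : redHom V x = 0) :
    ∃ y, (2 : ℤ) • y = x := by
  refine ⟨.ofCoeff (x.coeff.mapRange (· / 2) (by simp)), ?_⟩
  ext v
  have h : ((x.coeff v : ℤ) : ZMod 2) = 0 := congrArg (fun y => y.coeff v) hx
  rw [ZMod.intCast_zmod_eq_zero_iff_dvd] at h
  exact Int.mul_ediv_cancel' h

theorem redHom_two_smul (x : AddMonoidAlgebra ℤ V) : redHom V ((2 : ℤ) • x) = 0 := by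
  rw [map_zsmul, two_zsmul, ZModModule.add_self]

theorem aug_redHom (x : AddMonoidAlgebra ℤ V) :
    aug (ZMod 2) V (redHom V x) = (aug ℤ V x : ℤ) := by
  have h : (aug (ZMod 2) V : AddMonoidAlgebra (ZMod 2) V →+* ZMod 2).comp (redHom V) =
      (Int.castRingHom (ZMod 2)).comp (aug ℤ V : AddMonoidAlgebra ℤ V →+* ℤ) := by
    ext <;> simp [aug, redHom]
  exact congrArg (fun g => g x) h

theorem map_redHom_augIdeal : (augIdeal ℤ V).map (redHom V) = augIdeal (ZMod 2) V := by
  refine le_antisymm (Ideal.map_le_iff_le_comap.2 fun x hx => ?_) fun y hy => ?_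
  · have h := redHom_mem 1 x (by rwa [pow_one])
    rwa [pow_one] at h
  · obtain ⟨x, rfl⟩ := redHom_surjective y
    have h1 : redHom V (x - algebraMap ℤ _ (aug ℤ V x)) = redHom V x := by
      have h2 : ((aug ℤ V x : ℤ) : ZMod 2) = 0 := (aug_redHom x).symm.trans hy
      obtain ⟨c, hc⟩ := (ZMod.intCast_zmod_eq_zero_iff_dvd _ 2).1 h2
      rw [hc, map_sub, sub_eq_self, map_mul, ← redHom_two_smul (algebraMap ℤ _ c), zsmul_eq_mul]
      rfl
    rw [← h1]
    refine Ideal.mem_map_of_mem _ (?_ : aug ℤ V _ = 0)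
    rw [map_sub, AlgHom.commutes]
    simp

theorem exists_redHom_eq {n : ℕ} {y : AddMonoidAlgebra (ZMod 2) V}
    (hy : y ∈ augIdeal (ZMod 2) V ^ n) : ∃ x ∈ augIdeal ℤ V ^ n, redHom V x = y := by
  rw [← map_redHom_augIdeal, ← Ideal.map_pow] at hy
  exact (Ideal.mem_map_iff_of_surjective (redHom V) redHom_surjective).1 hy

end Reduction

/-! ### Morphisms from powers of the augmentation ideal -/

section Morphisms

variable {n : ℕ}

/-- The space `𝔽₂ⁿ`, lifted to the universe of the category `Vf`. -/
abbrev stdSpace (n : ℕ) : Vf.{u} := FGModuleCat.of (ZMod 2) (ULift.{u} (Fin n → ZMod 2))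

/-- The standard basis vectors of `𝔽₂ⁿ`. -/
def stdVec (i : Fin n) : stdSpace.{u} n := ULift.up (Pi.single i 1)

/-- The linear map `𝔽₂ⁿ → V` that sends the standard basis vectors to given vectors. -/
def stdMap {V : Vf.{u}} (v : Fin n → V) : stdSpace.{u} n ⟶ V :=
  FGModuleCat.ofHom (Fintype.linearCombination (ZMod 2) v ∘ₗ ULift.moduleEquiv.toLinearMap)

theorem stdMap_stdVec {V : Vf.{u}} (v : Fin n → V) (i : Fin n) :
    (stdMap v).hom.hom (stdVec i) = v i :=
  (Fintype.linearCombination_apply_single (ZMod 2) v i 1).trans (one_smul _ _)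

theorem dual_ext {M : Type*} [AddCommGroup M] [Module (ZMod 2) M]
    {f g : stdSpace.{u} n →ₗ[ZMod 2] M} (h : ∀ i, f (stdVec i) = g (stdVec i)) : f = g := by
  have h1 : f ∘ₗ ULift.moduleEquiv.symm.toLinearMap = g ∘ₗ ULift.moduleEquiv.symm.toLinearMap :=
    LinearMap.pi_ext' fun i => LinearMap.ext_ring (h i)
  ext ⟨x⟩
  exact LinearMap.congr_fun h1 x

/-- The value of a morphism `P̄ⁿ → Ī` at `∏ ([e_i] - 1) ∈ ℤ[𝔽₂ⁿ]`. -/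
def univValue (ψ : (Pbar.{u} ℤ n).toFunctor ⟶ Ibar.{u}) :
    redFun (Module.Dual (ZMod 2) (stdSpace.{u} n)) :=
  (ψ.app (stdSpace n)).hom (prodGen stdVec)

theorem map_prodGen {V W : Vf.{u}} (g : V ⟶ W) (v : Fin n → V) :
    ((Pbar.{u} ℤ n).toFunctor.map g).hom (prodGen v) = prodGen fun i => g.hom.hom (v i) := by
  refine Subtype.ext ?_
  change AddMonoidAlgebra.mapDomainRingHom ℤ g.hom.hom.toAddMonoidHom (∏ i, gen (v i)) =
    ∏ i, gen (g.hom.hom (v i))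
  rw [map_prod]
  exact Finset.prod_congr rfl fun i _ => mapDomain_gen _ _

theorem app_prodGen (ψ : (Pbar.{u} ℤ n).toFunctor ⟶ Ibar.{u}) {V : Vf.{u}} (v : Fin n → V)
    (χ : Module.Dual (ZMod 2) V) :
    ((ψ.app V).hom (prodGen v) : redFun (Module.Dual (ZMod 2) V)).1 χ =
      (univValue ψ).1 (χ ∘ₗ (stdMap v).hom.hom) := by
  have h1 : (prodGen v : (augIdeal ℤ V ^ n).toAddSubgroup) =
      ((Pbar.{u} ℤ n).toFunctor.map (stdMap v)).hom (prodGen stdVec) := by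
    rw [map_prodGen]
    exact congrArg prodGen (funext fun i => (stdMap_stdVec v i).symm)
  have h2 := ConcreteCategory.congr_hom (ψ.naturality (stdMap v)) (prodGen stdVec)
  rw [h1]
  exact congrArg (fun f : redFun (Module.Dual (ZMod 2) V) => f.1 χ) h2

/-- The function `univValue ψ` vanishes at a linear form `χ` with `χ e_i = 0`, since the linear map
that kills `e_i` and fixes the other basis vectors fixes `χ` and sends `∏ ([e_i] - 1)` to zero. -/
theorem univValue_eq_zero (ψ : (Pbar.{u} ℤ n).toFunctor ⟶ Ibar.{u})
    {χ : Module.Dual (ZMod 2) (stdSpace.{u} n)} {i : Fin n} (hi : χ (stdVec i) = 0) :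
    (univValue ψ).1 χ = 0 := by
  have h1 : χ = χ ∘ₗ (stdMap (Function.update stdVec i 0)).hom.hom := by
    refine dual_ext fun j => ?_
    rw [LinearMap.comp_apply, stdMap_stdVec]
    rcases eq_or_ne j i with rfl | hj
    · rw [Function.update_self, hi, map_zero]
    · rw [Function.update_of_ne hj]
  have h2 : prodGen (Function.update stdVec i (0 : stdSpace.{u} n)) = 0 := by
    refine Subtype.ext (Finset.prod_eq_zero (Finset.mem_univ i) ?_)
    rw [Function.update_self, gen_zero]
  rw [h1, ← app_prodGen, h2]
  exact congrArg (fun f : redFun (Module.Dual (ZMod 2) (stdSpace.{u} n)) => f.1 χ)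
    (map_zero (ψ.app (stdSpace n)).hom)

theorem hom_ext_univValue (hn : 0 < n) {ψ φ : (Pbar.{u} ℤ n).toFunctor ⟶ Ibar.{u}}
    (h : univValue ψ = univValue φ) : ψ = φ := by
  ext1
  ext1 V
  refine AddCommGrpCat.hom_ext (hom_ext_prodGen (V := V) hn fun v => ?_)
  refine Subtype.ext (funext fun χ => ?_)
  have h2 := app_prodGen ψ v χ
  rw [h] at h2
  exact h2.trans (app_prodGen φ v χ).symm

/-- There is at most one non-zero morphism `P̄ⁿ → Ī`: the function `univValue ψ` can be non-zero
only at the linear form with value `1` at all basis vectors. -/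
theorem hom_unique (hn : 0 < n) {ψ φ : (Pbar.{u} ℤ n).toFunctor ⟶ Ibar.{u}}
    (hψ : ψ ≠ 0) (hφ : φ ≠ 0) : ψ = φ := by
  have h1 : ∀ ψ : (Pbar.{u} ℤ n).toFunctor ⟶ Ibar.{u}, ψ ≠ 0 →
      ∀ χ, (∀ i, χ (stdVec i) ≠ 0) → (univValue ψ).1 χ = 1 := by
    intro ψ hψ χ hχ
    by_contra hne
    refine hψ (hom_ext_univValue hn (Subtype.ext (funext fun η => ?_)))
    change (univValue ψ).1 η = 0
    by_cases hη : ∃ i, η (stdVec i) = 0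
    · obtain ⟨i, hi⟩ := hη
      exact univValue_eq_zero ψ hi
    · have h : η = χ := dual_ext fun i => by
        rw [zmod_two_eq_ite (η _), zmod_two_eq_ite (χ _), if_pos (hχ i),
          if_pos fun h => hη ⟨i, h⟩]
      rw [h]
      by_contra h0
      exact hne (by simpa [h0] using zmod_two_eq_ite ((univValue ψ).1 χ))
  refine hom_ext_univValue hn (Subtype.ext (funext fun χ => ?_))
  by_cases hχ : ∃ i, χ (stdVec i) = 0
  · obtain ⟨i, hi⟩ := hχ
    rw [univValue_eq_zero ψ hi, univValue_eq_zero φ hi]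
  · rw [not_exists] at hχ
    rw [h1 ψ hψ χ hχ, h1 φ hφ χ hχ]

/-- The morphism `P̄ⁿ → Ī` with components `leading`. -/
def leadingHom (hn : 0 < n) : (Pbar.{u} ℤ n).toFunctor ⟶ Ibar.{u} where
  app V := AddCommGrpCat.ofHom (leading (V := V) hn)
  naturality V W f := by
    refine AddCommGrpCat.hom_ext (AddMonoidHom.ext fun x => Subtype.ext (funext fun χ => ?_))
    have h := ch_mapDomain f.hom.hom.toAddMonoidHom (χ : W →+ ZMod 2) x.1
    exact congrArg (fun m : ℤ => ((m / 2 ^ n : ℤ) : ZMod 2)) h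

theorem leadingHom_ne_zero (hn : 0 < n) : leadingHom.{u} hn ≠ 0 := by
  intro h
  let χ : Module.Dual (ZMod 2) (stdSpace.{u} n) :=
    Fintype.linearCombination (ZMod 2) (fun _ => (1 : ZMod 2)) ∘ₗ ULift.moduleEquiv.toLinearMap
  have hχ : ∀ i, χ (stdVec i) = 1 := fun i => by
    simp [χ, stdVec, Fintype.linearCombination_apply_single]
  have h1 : (leading hn (prodGen (stdVec.{u} (n := n)))).1 χ = 0 :=
    congrArg (fun ψ => (univValue ψ).1 χ) h
  rw [leading_prodGen] at h1
  simp [hχ] at h1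

/-- The morphism `leadingHom`, with target `p_n Ī`. -/
def leadingLift (hn : 0 < n) : (Pbar.{u} ℤ n).toFunctor ⟶ (pI.{u} n).toFunctor where
  app V := AddCommGrpCat.ofHom
    ((leading (V := V) hn).codRestrict ((pI.{u} n).obj V) fun x => leading_mem hn x)
  naturality V W f := by
    refine AddCommGrpCat.hom_ext (AddMonoidHom.ext fun x => Subtype.ext ?_)
    exact ConcreteCategory.congr_hom ((leadingHom.{u} hn).naturality f) x

theorem leadingLift_ι (hn : 0 < n) : leadingLift.{u} hn ≫ (pI n).ι = leadingHom hn := rfl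

theorem incl_comp_leadingLift (hn : 0 < n) :
    SubFA.incl (Pbar_succ_le.{u} ℤ n) ≫ leadingLift hn = 0 := by
  ext1
  ext1 V
  refine AddCommGrpCat.hom_ext (AddMonoidHom.ext fun x => Subtype.ext ?_)
  exact (leading_eq_zero_iff (V := V) hn ⟨x.1, Pbar_succ_le ℤ n V x.2⟩).2 x.2

theorem exact_leadingLift (hn : 0 < n) :
    (ShortComplex.mk _ _ (incl_comp_leadingLift.{u} hn)).Exact :=
  exact_of_forall fun V x hx =>
    ⟨⟨x.1, (leading_eq_zero_iff (V := V) hn x).1 (congrArg Subtype.val hx)⟩, rfl⟩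

instance epi_leadingLift (hn : 0 < n) : Epi (leadingLift.{u} hn) :=
  epi_of_surjective _ fun V f => by
    obtain ⟨x, hx⟩ := exists_leading_eq (V := V) hn f.2
    exact ⟨x, Subtype.ext hx⟩

end Morphisms

end IntegralGroupRing

end

theorem mainTheorem4 (n : ℕ) (hn : 0 < n) :
    (∃ (h : SubFA.mul 2 (Pbar.{u} ℤ n) ≤ Pbar ℤ (n + 1))
      (w : SubFA.incl h ≫ reductionPow (n + 1) = 0),
      (ShortComplex.mk (SubFA.incl h) (reductionPow (n + 1)) w).ShortExact) ∧
    (∃ φ : (Pbar.{u} ℤ n).toFunctor ⟶ Ibar.{u},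
      φ ≠ 0 ∧ (∀ ψ : (Pbar.{u} ℤ n).toFunctor ⟶ Ibar.{u}, ψ ≠ 0 → ψ = φ) ∧
      ∃ θ : cokernel (SubFA.incl (Pbar_succ_le.{u} ℤ n)) ≅ (pI.{u} n).toFunctor,
        cokernel.π (SubFA.incl (Pbar_succ_le.{u} ℤ n)) ≫ θ.hom ≫ (pI n).ι = φ) := by
  constructor
  · have h : SubFA.mul 2 (Pbar.{u} ℤ n) ≤ Pbar ℤ (n + 1) := by
      rintro V _ ⟨x, hx, rfl⟩
      exact two_smul_mem (V := V) hn hx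
    have w : SubFA.incl h ≫ reductionPow (n + 1) = 0 := by
      ext1
      ext1 V
      refine AddCommGrpCat.hom_ext (AddMonoidHom.ext fun x => Subtype.ext ?_)
      obtain ⟨_, y, hy, rfl⟩ := x
      exact redHom_two_smul (V := V) y
    refine ⟨h, w, ?_⟩
    have hmono : Mono (SubFA.incl h) := mono_of_injective _ fun V =>
      AddSubgroup.inclusion_injective (h V)
    have hepi : Epi (reductionPow.{u} (n + 1)) := epi_of_surjective _ fun V y => by
      obtain ⟨x, hx, hxy⟩ := exists_redHom_eq (V := V) y.2
      exact ⟨⟨x, hx⟩, Subtype.ext hxy⟩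
    refine { exact := exact_of_forall fun V x hx => ?_ }
    obtain ⟨y, hy⟩ := exists_two_smul_of_redHom_eq_zero (V := V) (congrArg Subtype.val hx)
    have hx2 : (2 : ℤ) • y ∈ augIdeal ℤ V ^ (n + 1) := by
      rw [hy]
      exact x.2
    exact ⟨⟨x.1, y, mem_of_two_smul_mem (V := V) hn hx2, hy⟩, rfl⟩
  · -- `leadingLift` is an epimorphism with kernel `P̄ⁿ⁺¹`, hence also a cokernel of the inclusion.
    refine ⟨leadingHom hn, leadingHom_ne_zero hn,
      fun ψ hψ => hom_unique hn hψ (leadingHom_ne_zero hn), ?_⟩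
    let e := (cokernelIsCokernel (SubFA.incl (Pbar_succ_le.{u} ℤ n))).coconePointUniqueUpToIso
      (exact_leadingLift.{u} hn).gIsCokernel
    refine ⟨e, ?_⟩
    have he : cokernel.π (SubFA.incl (Pbar_succ_le.{u} ℤ n)) ≫ e.hom = leadingLift hn :=
      (cokernelIsCokernel _).comp_coconePointUniqueUpToIso_hom _ WalkingParallelPair.one
    rw [← Category.assoc, he, leadingLift_ι]
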